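/- For integers $n,k\ge 1$ let $I^n=[0,1]^n$ and let $\mathcal K_k^n$ be the family of the $k^n$ cubes $\prod_{s=1}^n\left[\frac{i_s-1}{k},\frac{i_s}{k}\right]$ with $i_1,\dots,i_n\in\{1,\dots,k\}$. A set $S\subset I^n$ connects some opposite faces of $I^n$ if $S$ is connected and, for some $i\in\{1,\dots,n\}$, $S$ contains a point $z$ with $z_i=0$ and a point $z'$ with $z'_i=1$. A set $P\subset\mathbb Z^{n-1}$ (where $\mathbb Z^0=\{0\}$) is $1$-connected if any two of its points $x,y$ are joined by a finite sequence $x=p_1,\dots,p_N=y$ of points of $P$ with $\|p_{j}-p_{j+1}\|_\infty\le 1$ for all $1\le j<N$. Let $\dim$ denote topological (covering) dimension, with $\dim\emptyset=-1$. Theorem. Let $n\ge 1$ and $0\le m\le n-1$ be integers. Then there is a constant $C_{n,m}>0$ with the following property. Let $k\ge 1$ be an integer and let $F\colon\mathcal K_k^n\to\mathbb Z^{n-1}$ be a function such that $\|F(K_1)-F(K_2)\|_\infty\le 1$ for all $K_1,K_2\in\mathcal K_k^n$ with $\dim(K_1\cap K_2)\ge m$. Then there exist a $1$-connected set $P\subset\mathbb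 Z^{n-1}$ with $|P|\le C_{n,m}$ and a subfamily $\mathcal S\subset F^{-1}[P]$ such that $\bigcup\mathcal S$ connects some opposite faces of $I^n$. -/

import Mathlib

/-- `HasCoveringDimLT X d`: the Lebesgue covering dimension of `X` is less than `d`. Every finite
open cover of `X` has a finite open refinement such that each point of `X` lies in at most `d`
members of the refinement. For `d = 0` this says that `X` is empty. -/
def HasCoveringDimLT (X : Type*) [TopologicalSpace X] (d : ℕ) : Prop :=
  ∀ U : Set (Set X), U.Finite → (∀ A ∈ U, IsOpen A) → ⋃₀ U = Set.univ →
    ∃ V : Set (Set X), V.Finite ∧ (∀ B ∈ V, IsOpen B) ∧ ⋃₀ V = Set.univ ∧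
      (∀ B ∈ V, ∃ A ∈ U, B ⊆ A) ∧ ∀ x : X, {B ∈ V | x ∈ B}.encard ≤ d

/-- The topological (Lebesgue covering) dimension of a space: the least `d` such that the covering
dimension is less than every natural number above `d`. It is `⊥` (standing for `-1`) for the empty
space and `⊤` for a space of infinite dimension. -/
noncomputable def coveringDim (X : Type*) [TopologicalSpace X] : WithBot ℕ∞ :=
  sInf {d : WithBot ℕ∞ | ∀ r : ℕ, d < (r : WithBot ℕ∞) → HasCoveringDimLT X r}

/-- The relation between the dimension and the bound on the orders of refinements. -/
theorem le_coveringDim_iff (X : Type*) [TopologicalSpace X] (r : ℕ) :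
    (r : WithBot ℕ∞) ≤ coveringDim X ↔ ¬ HasCoveringDimLT X r := by
  set T := {d : WithBot ℕ∞ | ∀ r : ℕ, d < (r : WithBot ℕ∞) → HasCoveringDimLT X r} with hT
  have hmem : sInf T ∈ T := csInf_mem (s := T) ⟨⊤, fun r h => absurd h not_top_lt⟩
  constructor
  · intro h hlt
    have hmono : ∀ s : ℕ, r ≤ s → HasCoveringDimLT X s := by
      intro s hs U h1 h2 h3
      obtain ⟨V, a, b, c, e, f⟩ := hlt U h1 h2 h3
      exact ⟨V, a, b, c, e, fun x => (f x).trans (by exact_mod_cast hs)⟩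
    cases r with
    | zero =>
      have : (⊥ : WithBot ℕ∞) ∈ T := fun s _ => hmono s (Nat.zero_le s)
      have h2 : ((0 : ℕ) : WithBot ℕ∞) ≤ ⊥ := h.trans (sInf_le this)
      exact absurd (le_bot_iff.mp h2) (by exact WithBot.coe_ne_bot)
    | succ q =>
      have : ((q : ℕ) : WithBot ℕ∞) ∈ T := fun s hs => hmono s (by
        have : q < s := by exact_mod_cast hs
        exact this)
      have h2 : ((q + 1 : ℕ) : WithBot ℕ∞) ≤ (q : ℕ) := h.trans (sInf_le this)
      have h3 : q + 1 ≤ q := by exact_mod_cast h2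
      omega
  · intro h
    by_contra hlt
    exact h (hmem r (not_le.mp hlt))

/-- The unit cube `I^n = [0, 1]^n`. -/
def unitCube (n : ℕ) : Set (Fin n → ℝ) := {z | ∀ s, 0 ≤ z s ∧ z s ≤ 1}

/-- The subcube with (zero-based) index `i`: the product of the intervals
`[i s / k, (i s + 1) / k]`. -/
def gridCube (n k : ℕ) (i : Fin n → Fin k) : Set (Fin n → ℝ) :=
  {z | ∀ s, ((i s : ℕ) : ℝ) / k ≤ z s ∧ z s ≤ (((i s : ℕ) : ℝ) + 1) / k}

/-- The family of the `k ^ n` subcubes into which `I^n` is divided. -/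
def cubeFamily (n k : ℕ) : Set (Set (Fin n → ℝ)) := Set.range (gridCube n k)

/-- The face of `I^n` on which the `i`th coordinate is `0`. -/
def lowerFace (n : ℕ) (i : Fin n) : Set (Fin n → ℝ) := {z ∈ unitCube n | z i = 0}

/-- The face of `I^n` on which the `i`th coordinate is `1`. -/
def upperFace (n : ℕ) (i : Fin n) : Set (Fin n → ℝ) := {z ∈ unitCube n | z i = 1}

/-- The subset `S` of `I^n` connects the `i`th opposite faces of `I^n`. -/
def ConnectsOppositeFaces (n : ℕ) (i : Fin n) (S : Set (Fin n → ℝ)) : Prop :=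
  S ⊆ unitCube n ∧ IsConnected S ∧
    (S ∩ lowerFace n i).Nonempty ∧ (S ∩ upperFace n i).Nonempty

/-- The subset `S` of `I^n` connects some opposite faces of `I^n`. -/
def ConnectsSomeOppositeFaces (n : ℕ) (S : Set (Fin n → ℝ)) : Prop :=
  ∃ i : Fin n, ConnectsOppositeFaces n i S

/-- A sequence of `N + 1` points is an `r`-path if consecutive points are at distance at most
`r`. -/
def IsRPath {X : Type*} [MetricSpace X] (r : ℝ) {N : ℕ} (p : Fin (N + 1) → X) : Prop :=
  ∀ j : Fin N, dist (p j.castSucc) (p j.succ) ≤ r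

/-- A set is `r`-connected if any two of its points are joined by an `r`-path inside the set. -/
def IsRConnected {X : Type*} [MetricSpace X] (r : ℝ) (S : Set X) : Prop :=
  ∀ x ∈ S, ∀ y ∈ S, ∃ (N : ℕ) (p : Fin (N + 1) → X),
    IsRPath r p ∧ (∀ j, p j ∈ S) ∧ p 0 = x ∧ p (Fin.last N) = y

/-! Put `n = d + 1`. Two cubes with a common facet meet in dimension at least `d ≥ m`, so `F`
changes by at most 1 across facets, and by at most `d + 1` between touching cubes, since these
differ by at most one step in each coordinate. Cut `ℤ ^ d` into blocks of side `d + 1` and give a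
block a colour `j` in `0, …, d` such that none of its block coordinates is congruent to `j` modulo
`d + 1`. Each coordinate excludes only one colour, so one remains (`exists_colour`). Blocks of
colour `j` lie in bricks separated by gaps one block wide, which a jump of at most `d + 1` cannot
cross (`brickIndex_eq`). Pulling the colours back along `F` colours the cubes with `n` colours. By
the Hex theorem (`exists_monochromatic_path`) some colour `i` has a chain of touching cubes joining
the `i`th opposite faces. Along it the values of `F` stay in one brick, a box of side `(d + 1) ^ 2`,
which serves as `P`. Sperner's lemma, counted modulo 2, gives Kuhn's cubical lemma; this yields both
the Hex theorem and the lower bound `d` for the covering dimension of a common facet. -/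

/-! ### Sperner's lemma modulo 2 and Kuhn's cubical lemma -/

/-- The `j`th vertex of the simplex of the Freudenthal triangulation with base point `v` and
permutation `π`. -/
def freudenthalVertex {n : ℕ} (v : Fin n → ℕ) (π : Equiv.Perm (Fin n)) (j : ℕ) : Fin n → ℕ :=
  fun s => v s + if j ≤ (π s : ℕ) then 1 else 0

/-- The labels `1, …, n` all occur away from the index `j`. -/
def FacetLabelled {n : ℕ} (f : Fin (n + 1) → ℕ) (j : Fin (n + 1)) : Prop :=
  ∀ l, 1 ≤ l → l ≤ n → ∃ i, i ≠ j ∧ f i = l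

/-- The labels `0, …, n` all occur. -/
def FullyLabelled {n : ℕ} (f : Fin (n + 1) → ℕ) : Prop := ∀ l, l ≤ n → ∃ i, f i = l

/-- The facet has `n` vertices and `n` labels to realise, so no label repeats. -/
theorem FacetLabelled.injOn {n : ℕ} {f : Fin (n + 1) → ℕ} (hf : ∀ i, f i ≠ 0 ∧ f i ≤ n)
    {j : Fin (n + 1)} (hj : FacetLabelled f j) :
    Set.InjOn f ((Finset.univ.erase j : Finset (Fin (n + 1))) : Set (Fin (n + 1))) := by
  apply Finset.injOn_of_surjOn_of_card_le (t := Finset.Icc 1 n)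
  · intro i _
    have := hf i
    simp; omega
  · intro l hl
    simp at hl
    obtain ⟨i, hi, rfl⟩ := hj l hl.1 hl.2
    exact ⟨i, by simpa using hi, rfl⟩
  · simp

open Classical in
/-- Modulo 2, the number of facets labelled `1, …, n` of an `n`-simplex with labels in
`0, …, n` is one if all the labels occur and zero otherwise. -/
theorem sum_facetLabelled {n : ℕ} (f : Fin (n + 1) → ℕ) (hf : ∀ i, f i ≤ n) :
    ∑ j, (if FacetLabelled f j then (1 : ZMod 2) else 0) =
      if FullyLabelled f then 1 else 0 := by
  split_ifs with h
  · have hinj : Function.Injective f := by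
      rw [← Set.injOn_univ, ← Finset.coe_univ]
      apply Finset.injOn_of_surjOn_of_card_le (t := Finset.range (n + 1))
      · intro i _
        have := hf i
        simp; omega
      · intro l hl
        simp at hl
        obtain ⟨i, rfl⟩ := h l (by omega)
        exact ⟨i, by simp, rfl⟩
      · simp
    obtain ⟨i₀, hi₀⟩ := h 0 (Nat.zero_le _)
    rw [Finset.sum_eq_single i₀]
    · rw [if_pos]
      intro l h1 h2
      obtain ⟨i, hi⟩ := h l h2
      exact ⟨i, by rintro rfl; omega, hi⟩
    · intro j _ hj
      rw [if_neg]
      intro hF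
      have hne : f j ≠ 0 := fun h0 => hj (hinj (h0.trans hi₀.symm))
      obtain ⟨i, hi, hi2⟩ := hF (f j) (by omega) (hf j)
      exact hi (hinj hi2)
    · simp
  · by_cases hex : ∃ j, FacetLabelled f j
    · obtain ⟨j₁, hj₁⟩ := hex
      have hne : ∀ i, f i ≠ 0 := by
        intro i hi
        apply h
        intro l hl
        rcases Nat.eq_zero_or_pos l with rfl | hl0
        · exact ⟨i, hi⟩
        · obtain ⟨i, -, hi⟩ := hj₁ l hl0 hl
          exact ⟨i, hi⟩
      -- Label 0 is absent, so `j₁` and `j₂` share the only repeated label, and exactly the two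
      -- facets omitting one of them count.
      obtain ⟨j₂, hj₂, hjj⟩ := hj₁ (f j₁) (Nat.pos_of_ne_zero (hne _)) (hf _)
      have hinj := hj₁.injOn fun i => ⟨hne i, hf i⟩
      have key : ∀ j, FacetLabelled f j ↔ j = j₁ ∨ j = j₂ := by
        intro j
        constructor
        · intro hj
          by_contra! hc
          obtain ⟨i, hi, hij⟩ := hj (f j) (Nat.pos_of_ne_zero (hne _)) (hf _)
          by_cases hi1 : i = j₁
          · subst hi1
            exact hc.2 (hinj (by simpa using hc.1) (by simpa using hj₂) (by omega))
          · exact hi (hinj (by simpa using hi1) (by simpa using hc.1) hij)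
        · rintro (rfl | rfl)
          · exact hj₁
          · intro l h1 h2
            obtain ⟨i, hi, rfl⟩ := hj₁ l h1 h2
            by_cases hij : i = j
            · exact ⟨j₁, hj₂.symm, by rw [hij, hjj]⟩
            · exact ⟨i, hij, rfl⟩
      simp only [key]
      rw [← Finset.sum_filter, Finset.sum_const]
      have : (Finset.univ.filter fun j => j = j₁ ∨ j = j₂) = {j₁, j₂} := by
        ext; simp
      rw [this, Finset.card_pair hj₂.symm]
      decide
    · push Not at hex
      simp [hex]

/-- The labels of the vertices of a simplex of the Freudenthal triangulation. -/
def vertexLabels {n : ℕ} (lab : (Fin n → ℕ) → ℕ) (v : Fin n → ℕ) (π : Equiv.Perm (Fin n)) :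
    Fin (n + 1) → ℕ := fun j => lab (freudenthalVertex v π j)

open Classical in
/-- The sum over the permutations cancels for the facets in the interior of a unit cube. -/
theorem sum_facetLabelled_inner {n : ℕ} (lab : (Fin (n + 1) → ℕ) → ℕ) (v : Fin (n + 1) → ℕ)
    (j : Fin n) :
    ∑ π, (if FacetLabelled (vertexLabels lab v π) j.castSucc.succ then (1 : ZMod 2) else 0)
      = 0 := by
  -- Exchanging the values `j` and `j + 1` of `π` moves only vertex `j + 1`, the one the facet
  -- omits; so the permutations cancel in pairs.
  have key : ∀ (π : Equiv.Perm (Fin (n + 1))) (i : Fin (n + 2)), i ≠ j.castSucc.succ →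
      vertexLabels lab v (π.trans (Equiv.swap j.castSucc j.succ)) i = vertexLabels lab v π i := by
    intro π i hi
    have hi' : (i : ℕ) ≠ j + 1 := fun h => hi (Fin.ext (by simpa using h))
    unfold vertexLabels
    congr 1
    funext s
    simp only [freudenthalVertex, Equiv.trans_apply]
    rcases eq_or_ne (π s) j.castSucc with h | h
    · simp only [h, Equiv.swap_apply_left, Fin.val_succ, Fin.val_castSucc]
      congr 2
      apply propext; omega
    · rcases eq_or_ne (π s) j.succ with h' | h'
      · simp only [h', Equiv.swap_apply_right, Fin.val_succ, Fin.val_castSucc]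
        congr 2
        apply propext; omega
      · simp only [Equiv.swap_apply_of_ne_of_ne h h']
  have key2 : ∀ π : Equiv.Perm (Fin (n + 1)),
      FacetLabelled (vertexLabels lab v (π.trans (Equiv.swap j.castSucc j.succ))) j.castSucc.succ ↔
      FacetLabelled (vertexLabels lab v π) j.castSucc.succ := by
    intro π
    unfold FacetLabelled
    refine forall_congr' fun l => forall_congr' fun _ => forall_congr' fun _ =>
      exists_congr fun i => and_congr_right fun hi => ?_
    rw [key π i hi]
  apply Finset.sum_involution (fun π _ => π.trans (Equiv.swap j.castSucc j.succ))
  · intro π _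
    simp only [key2]
    exact CharTwo.add_self_eq_zero _
  · intro π _ _ h
    have h1 := congrArg (fun σ : Equiv.Perm (Fin (n + 1)) => (σ (π.symm j.castSucc) : ℕ)) h
    simp at h1
  · intro π _
    ext s
    simp
  · simp

/-- Passing to the adjacent simplex across the facet that omits the last vertex. -/
theorem facetLabelled_last_iff {n : ℕ} (lab : (Fin (n + 1) → ℕ) → ℕ) (v : Fin (n + 1) → ℕ)
    (π : Equiv.Perm (Fin (n + 1))) :
    FacetLabelled (vertexLabels lab v π) (Fin.last (n + 1)) ↔
      FacetLabelled (vertexLabels lab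
        (fun s => v s + if π.trans (finRotate (n + 1)) s = 0 then 1 else 0)
        (π.trans (finRotate (n + 1)))) 0 := by
  -- The neighbour has its base moved one step in the coordinate where `π` is maximal; rotating `π`
  -- makes old vertex `i` the new vertex `i + 1`.
  have key : ∀ i : Fin (n + 1), vertexLabels lab
        (fun s => v s + if π.trans (finRotate (n + 1)) s = 0 then 1 else 0)
        (π.trans (finRotate (n + 1))) i.succ = vertexLabels lab v π i.castSucc := by
    intro i
    unfold vertexLabels
    congr 1
    funext s
    simp only [freudenthalVertex, Equiv.trans_apply, Fin.val_succ, Fin.val_castSucc]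
    rcases Fin.eq_castSucc_or_eq_last (π s) with ⟨t, ht⟩ | h
    · simp [ht, Fin.succ_ne_zero]
    · have := i.2
      simp only [h]
      simp
      omega
  unfold FacetLabelled
  refine forall_congr' fun l => forall_congr' fun _ => forall_congr' fun _ => ?_
  constructor
  · rintro ⟨i, hi, h⟩
    obtain ⟨i', rfl⟩ := Fin.exists_castSucc_eq.mpr hi
    exact ⟨i'.succ, Fin.succ_ne_zero _, by rw [key, h]⟩
  · rintro ⟨i, hi, h⟩
    obtain ⟨i', rfl⟩ := Fin.exists_succ_eq.mpr hi
    exact ⟨i'.castSucc, Fin.castSucc_ne_last _, by rw [← key, h]⟩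

/-- The points of the grid `{0, …, k - 1} ^ n`. -/
def gridBox (n k : ℕ) : Finset (Fin n → ℕ) := Fintype.piFinset fun _ => Finset.range k

theorem mem_gridBox {n k : ℕ} {v : Fin n → ℕ} : v ∈ gridBox n k ↔ ∀ s, v s < k := by
  simp [gridBox]

/-- Translating by a unit vector, modulo 2. -/
theorem sum_add_sum_shift {n k : ℕ} (s : Fin n) (g : (Fin n → ℕ) → ZMod 2)
    (hg : ∀ v, (∀ t, t ≠ s → v t < k) → v s = k → g v = 0) :
    ∑ v ∈ gridBox n k, g v + ∑ v ∈ gridBox n k, g (fun t => v t + if t = s then 1 else 0) =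
      ∑ v ∈ gridBox n k with v s = 0, g v := by
  have h1 : ∑ v ∈ gridBox n k, g (fun t => v t + if t = s then 1 else 0) =
      ∑ v ∈ gridBox n k with ¬ v s = 0, g v := by
    rw [← Finset.sum_filter_of_ne (p := fun v => v s + 1 < k)]
    · refine Finset.sum_nbij' (fun v t => v t + if t = s then 1 else 0)
        (fun v t => v t - if t = s then 1 else 0) ?_ ?_ ?_ ?_ ?_
      · intro v hv
        simp only [Finset.mem_filter, mem_gridBox] at hv ⊢
        refine ⟨fun t => ?_, by simp⟩
        have := hv.1 t
        split_ifs with h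
        · subst h; exact hv.2
        · exact this
      · intro v hv
        simp only [Finset.mem_filter, mem_gridBox] at hv ⊢
        refine ⟨fun t => ?_, ?_⟩
        · have := hv.1 t
          omega
        · have := hv.1 s
          simp; omega
      · intro v hv
        funext t
        simp
      · intro v hv
        simp only [Finset.mem_filter, mem_gridBox] at hv
        funext t
        by_cases h : t = s
        · subst h; have := hv.2; simp; omega
        · simp [h]
      · intros; rfl
    · intro v hv hne
      rw [mem_gridBox] at hv
      by_contra hlt
      apply hne
      have h2 := hv s
      apply hg
      · intro t ht
        simpa [ht] using hv t
      · simp; omega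
  rw [h1, ← Finset.sum_filter_add_sum_filter_not (gridBox n k) (fun v => v s = 0), add_assoc,
    CharTwo.add_self_eq_zero, add_zero]

open Classical in
/-- **Sperner's lemma** for the Freudenthal triangulation of a cube: modulo 2, the number of fully
labelled simplices is one. -/
theorem sum_fullyLabelled {k : ℕ} (hk0 : 0 < k) : ∀ (n : ℕ) (lab : (Fin n → ℕ) → ℕ), (∀ x, lab x ≤ n) →
    (∀ x, (∀ s, x s ≤ k) → ∀ i : Fin n, x i = 0 → (i : ℕ) < lab x) →
    (∀ x, (∀ s, x s ≤ k) → ∀ i : Fin n, x i = k → lab x ≠ i + 1) →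
    ∑ v ∈ gridBox n k, ∑ π, (if FullyLabelled (vertexLabels lab v π) then (1 : ZMod 2) else 0)
      = 1 := by
  intro n
  induction n with
  | zero =>
    intro lab hle _ _
    have : gridBox 0 k = {fun i => i.elim0} := by
      ext v
      simp only [mem_gridBox, IsEmpty.forall_iff, Finset.mem_singleton, true_iff]
      exact Subsingleton.elim _ _
    rw [this, Finset.sum_singleton, Fintype.sum_subsingleton _ 1, if_pos]
    intro l hl
    exact ⟨0, by have := hle (freudenthalVertex (fun i => i.elim0) 1 0); simp [vertexLabels]; omega⟩
  | succ n ih =>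
    intro lab hle h0 hk
    set D : (Fin (n + 1) → ℕ) → Equiv.Perm (Fin (n + 1)) → Fin (n + 2) → ZMod 2 :=
      fun v π j => if FacetLabelled (vertexLabels lab v π) j then (1 : ZMod 2) else 0 with hD
    have hvert : ∀ (v : Fin (n + 1) → ℕ) (π : Equiv.Perm (Fin (n + 1))) (j : Fin (n + 2)),
        j ≠ 0 → freudenthalVertex v π j (π.symm 0) = v (π.symm 0) := by
      intro v π j hj
      have : (j : ℕ) ≠ 0 := fun h => hj (Fin.ext h)
      simp [freudenthalVertex, this]
    have hbd : ∀ (v : Fin (n + 1) → ℕ) (π : Equiv.Perm (Fin (n + 1))) (j : Fin (n + 2)),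
        j ≠ 0 → (∀ t, v t ≤ k) → (∀ t, t ≠ π.symm 0 → v t < k) →
        ∀ t, freudenthalVertex v π j t ≤ k := by
      intro v π j hj hv hv' t
      by_cases ht : t = π.symm 0
      · rw [ht, hvert v π j hj]; exact hv _
      · have := hv' t ht
        simp only [freudenthalVertex]
        split_ifs <;> omega
    have hsplit : ∀ v π, (if FullyLabelled (vertexLabels lab v π) then (1 : ZMod 2) else 0) =
        D v π 0 + (∑ j : Fin n, D v π j.castSucc.succ + D v π (Fin.last (n + 1))) := by
      intro v π
      rw [← sum_facetLabelled (vertexLabels lab v π) (fun i => hle _), Fin.sum_univ_succ, Fin.sum_univ_castSucc]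
      rfl
    have hinner : ∀ v, ∑ π, ∑ j : Fin n, D v π j.castSucc.succ = 0 := by
      intro v
      rw [Finset.sum_comm]
      exact Finset.sum_eq_zero fun j _ => sum_facetLabelled_inner lab v j
    have hlast : ∀ v, ∑ π, D v π (Fin.last (n + 1)) =
        ∑ π : Equiv.Perm (Fin (n + 1)), D (fun t => v t + if t = π.symm 0 then 1 else 0) π 0 := by
      intro v
      refine Fintype.sum_equiv (Equiv.mulLeft (finRotate (n + 1))) _ _ fun π => ?_
      simp only [hD]
      rw [if_congr (facetLabelled_last_iff lab v π) rfl rfl]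
      have : Equiv.mulLeft (finRotate (n + 1)) π = π.trans (finRotate (n + 1)) := rfl
      rw [this]
      simp only [Equiv.eq_symm_apply]
    -- With `s = π.symm 0`, facets between neighbouring cubes cancel, and those on `x s = k` lack
    -- the label `s + 1`.
    have hshift : ∀ π : Equiv.Perm (Fin (n + 1)), ∑ v ∈ gridBox (n + 1) k, D v π 0 +
        ∑ v ∈ gridBox (n + 1) k, D (fun t => v t + if t = π.symm 0 then 1 else 0) π 0 =
        ∑ v ∈ gridBox (n + 1) k with v (π.symm 0) = 0, D v π 0 := by
      intro π
      apply sum_add_sum_shift (π.symm 0) (fun v => D v π 0)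
      intro v hv hvk
      simp only [hD]
      rw [if_neg]
      intro hF
      have hle' : ∀ t, v t ≤ k := by
        intro t
        by_cases ht : t = π.symm 0
        · rw [ht, hvk]
        · exact (hv t ht).le
      obtain ⟨j, hj, hj1⟩ := hF ((π.symm 0 : Fin (n + 1)) + 1) (by omega) (by omega)
      exact hk (freudenthalVertex v π j) (hbd v π j hj hle' hv) (π.symm 0)
        (by rw [hvert v π j hj, hvk]) hj1
    -- On `x s = 0` with `s > 0` all labels exceed `s`, so label 1 is missing.
    have hzero : ∀ π : Equiv.Perm (Fin (n + 1)), π.symm 0 ≠ 0 →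
        ∑ v ∈ gridBox (n + 1) k with v (π.symm 0) = 0, D v π 0 = 0 := by
      intro π hπ
      refine Finset.sum_eq_zero fun v hv => ?_
      simp only [Finset.mem_filter, mem_gridBox] at hv
      simp only [hD]
      rw [if_neg]
      intro hF
      obtain ⟨j, hj, hj1⟩ := hF 1 le_rfl (by omega)
      have := h0 (freudenthalVertex v π j)
        (hbd v π j hj (fun t => (hv.1 t).le) fun t _ => hv.1 t) (π.symm 0)
        (by rw [hvert v π j hj]; exact hv.2)
      have h2 : ((π.symm 0 : Fin (n + 1)) : ℕ) ≠ 0 := fun h => hπ (Fin.ext h)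
      unfold vertexLabels at hj1
      omega
    -- On the remaining face `x 0 = 0` labels are positive; lowering them by one gives the labelling
    -- for the induction.
    have hstep : ∀ e : Equiv.Perm (Fin n), ∑ v ∈ gridBox (n + 1) k with v 0 = 0,
        D v (Equiv.Perm.decomposeFin.symm (0, e)) 0 = ∑ v ∈ gridBox n k,
          if FullyLabelled (vertexLabels (fun x => lab (Fin.cons 0 x) - 1) v e)
            then (1 : ZMod 2) else 0 := by
      intro e
      refine Finset.sum_nbij' (fun v => Fin.tail v) (fun v => Fin.cons 0 v) ?_ ?_ ?_ ?_ ?_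
      · intro v hv
        simp only [Finset.mem_filter, mem_gridBox] at hv ⊢
        exact fun s => hv.1 _
      · intro v hv
        simp only [Finset.mem_filter, mem_gridBox] at hv ⊢
        refine ⟨fun t => ?_, rfl⟩
        refine Fin.cases ?_ (fun s => ?_) t
        · exact hk0
        · exact hv s
      · intro v hv
        simp only [Finset.mem_filter] at hv
        rw [← hv.2, Fin.cons_self_tail]
      · intro v hv
        simp
      · intro v hv
        simp only [Finset.mem_filter, mem_gridBox] at hv
        have hvv : ∀ j : Fin (n + 1), freudenthalVertex v (Equiv.Perm.decomposeFin.symm (0, e)) j.succ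
            = Fin.cons 0 (freudenthalVertex (Fin.tail v) e j) := by
          intro j
          funext s
          refine Fin.cases ?_ (fun s => ?_) s
          · simp [freudenthalVertex, hv.2]
          · simp [freudenthalVertex, Fin.tail]
        have hpos : ∀ j : Fin (n + 1), 0 < lab (Fin.cons 0 (freudenthalVertex (Fin.tail v) e j)) := by
          intro j
          refine h0 _ (fun s => ?_) 0 rfl
          rw [← hvv]
          apply hbd _ _ _ (Fin.succ_ne_zero _) (fun t => (hv.1 t).le) fun t _ => hv.1 t
        simp only [hD]
        refine if_congr ?_ rfl rfl
        constructor
        · intro hF l hl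
          obtain ⟨j, hj, hjl⟩ := hF (l + 1) (by omega) (by omega)
          obtain ⟨i, rfl⟩ := Fin.exists_succ_eq.mpr hj
          refine ⟨i, ?_⟩
          simp only [vertexLabels, hvv] at hjl ⊢
          omega
        · intro hF l hl hl'
          obtain ⟨i, hi⟩ := hF (l - 1) (by omega)
          refine ⟨i.succ, Fin.succ_ne_zero _, ?_⟩
          have := hpos i
          simp only [vertexLabels, hvv] at hi ⊢
          omega
    simp only [hsplit, Finset.sum_add_distrib, hinner, hlast, zero_add]
    rw [Finset.sum_comm, Finset.sum_comm (s := gridBox (n + 1) k), ← Finset.sum_add_distrib,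
      Finset.sum_congr rfl fun π _ => hshift π, ← Equiv.sum_comp Equiv.Perm.decomposeFin.symm,
      Fintype.sum_prod_type, Fintype.sum_eq_single 0]
    · have hsymm : ∀ e : Equiv.Perm (Fin n),
          (Equiv.Perm.decomposeFin.symm (0, e)).symm 0 = 0 := by
        intro e
        rw [Equiv.symm_apply_eq]
        simp
      simp only [hsymm, hstep]
      rw [Finset.sum_comm]
      apply ih
      · intro x
        have := hle (Fin.cons 0 x)
        omega
      · intro x hx i hi
        have := h0 (Fin.cons 0 x) (fun s => Fin.cases (Nat.zero_le _) hx s) i.succ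
          (by simpa using hi)
        simp at this
        omega
      · intro x hx i hi
        have := hk (Fin.cons 0 x) (fun s => Fin.cases (Nat.zero_le _) hx s) i.succ
          (by simpa using hi)
        simp at this
        omega
    · intro p hp
      refine Finset.sum_eq_zero fun e _ => hzero _ fun h => hp ?_
      rw [Equiv.symm_apply_eq] at h
      simpa using h.symm

/-- **Kuhn's cubical lemma**: some unit cube of the grid carries all the labels. -/
theorem exists_unitCube_fullyLabelled {n k : ℕ} (hk0 : 0 < k) (lab : (Fin n → ℕ) → ℕ)
    (hle : ∀ x, lab x ≤ n)
    (h0 : ∀ x, (∀ s, x s ≤ k) → ∀ i : Fin n, x i = 0 → (i : ℕ) < lab x)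
    (hk : ∀ x, (∀ s, x s ≤ k) → ∀ i : Fin n, x i = k → lab x ≠ i + 1) :
    ∃ v : Fin n → ℕ, (∀ s, v s < k) ∧
      ∀ l, l ≤ n → ∃ x : Fin n → ℕ, (∀ s, v s ≤ x s ∧ x s ≤ v s + 1) ∧ lab x = l := by
  classical
  have h := sum_fullyLabelled hk0 n lab hle h0 hk
  obtain ⟨v, hv, hne⟩ := Finset.exists_ne_zero_of_sum_ne_zero (h.trans_ne one_ne_zero)
  obtain ⟨π, -, hπ⟩ := Finset.exists_ne_zero_of_sum_ne_zero hne
  have hF : FullyLabelled (vertexLabels lab v π) := by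
    by_contra hF
    simp [hF] at hπ
  refine ⟨v, mem_gridBox.mp hv, fun l hl => ?_⟩
  obtain ⟨j, hj⟩ := hF l hl
  refine ⟨freudenthalVertex v π j, fun s => ?_, hj⟩
  simp only [freudenthalVertex]
  split_ifs <;> omega

/-! ### The Hex theorem -/

open Classical in
/-- One plus the last index at which `p` holds, or zero if there is no such index. -/
noncomputable def lastLabel {n : ℕ} (p : Fin n → Prop) : ℕ :=
  (Finset.univ.filter p).sup fun i => (i : ℕ) + 1

theorem lastLabel_le {n : ℕ} (p : Fin n → Prop) : lastLabel p ≤ n :=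
  Finset.sup_le fun i _ => i.2

theorem lt_lastLabel {n : ℕ} {p : Fin n → Prop} {i : Fin n} (h : p i) : (i : ℕ) < lastLabel p := by
  classical
  exact Finset.le_sup (f := fun i : Fin n => (i : ℕ) + 1) (by simpa using h)

theorem of_lastLabel_eq {n : ℕ} {p : Fin n → Prop} {i : Fin n} (h : lastLabel p = i + 1) :
    p i := by
  classical
  by_cases he : (Finset.univ.filter p).Nonempty
  · obtain ⟨j, hj, hji⟩ := Finset.exists_mem_eq_sup _ he fun i : Fin n => (i : ℕ) + 1
    have : j = i := by
      apply Fin.ext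
      have h2 := h
      unfold lastLabel at h2
      omega
    subst this
    simpa using hj
  · rw [Finset.not_nonempty_iff_eq_empty] at he
    unfold lastLabel at h
    rw [he] at h
    simp at h

/-- Two cells of a grid touch if their coordinates differ by at most one. -/
def Touching {n k : ℕ} (a b : Fin n → Fin k) : Prop :=
  ∀ s, (a s : ℕ) ≤ b s + 1 ∧ (b s : ℕ) ≤ a s + 1

/-- Two cells touch and both have the colour `i`. -/
def TouchingOfColour {n k : ℕ} {ι : Type*} (c : (Fin n → Fin k) → ι) (i : ι)
    (a b : Fin n → Fin k) : Prop :=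
  Touching a b ∧ c a = i ∧ c b = i

/-- The `n`-dimensional **Hex theorem** (Steinhaus chessboard theorem). -/
theorem exists_monochromatic_path {n k : ℕ} (hk0 : 0 < k) (c : (Fin n → Fin k) → Fin n) :
    ∃ i x y, (x i : ℕ) = 0 ∧ (y i : ℕ) + 1 = k ∧ c x = i ∧
      Relation.ReflTransGen (TouchingOfColour c i) x y := by
  classical
  by_contra! hno
  -- Vertices with positive coordinates stand for cells, shifted by one; those with a zero
  -- coordinate form a collar, where `lab` ignores `cell`.
  let cell : (Fin n → ℕ) → Fin n → Fin k := fun x s => ⟨min (x s - 1) (k - 1), by omega⟩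
  let reach : (Fin n → Fin k) → Prop := fun a =>
    ∃ x, (x (c a) : ℕ) = 0 ∧ c x = c a ∧ Relation.ReflTransGen (TouchingOfColour c (c a)) x a
  let lab : (Fin n → ℕ) → ℕ := fun x =>
    if ∃ i, x i = 0 then lastLabel fun i => x i = 0
    else if reach (cell x) then (c (cell x) : ℕ) + 1 else 0
  have hmem : ∀ x (i : Fin n), lab x = i + 1 →
      x i = 0 ∨ (∀ s, x s ≠ 0) ∧ reach (cell x) ∧ c (cell x) = i := by
    intro x i hx
    simp only [lab] at hx
    split_ifs at hx with h1 h2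
    · exact Or.inl (of_lastLabel_eq hx)
    · push Not at h1
      exact Or.inr ⟨h1, h2, Fin.ext (by omega)⟩
  have hle : ∀ x, lab x ≤ n := by
    intro x
    simp only [lab]
    split_ifs
    · exact lastLabel_le _
    · exact (c (cell x)).2
    · exact Nat.zero_le _
  have h0 : ∀ x, (∀ s, x s ≤ k) → ∀ i : Fin n, x i = 0 → (i : ℕ) < lab x := by
    intro x _ i hi
    have hex : ∃ i, x i = 0 := ⟨i, hi⟩
    simp only [lab, if_pos hex]
    exact lt_lastLabel (p := fun i => x i = 0) hi
  have hk : ∀ x, (∀ s, x s ≤ k) → ∀ i : Fin n, x i = k → lab x ≠ i + 1 := by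
    intro x _ i hi hx
    rcases hmem x i hx with h | ⟨-, ⟨y, hy, hyc, hyr⟩, hci⟩
    · omega
    · rw [hci] at hy hyc hyr
      refine hno i y (cell x) hy ?_ hyc hyr
      simp only [cell]
      omega
  obtain ⟨v, hv, hl⟩ := exists_unitCube_fullyLabelled hk0 lab hle h0 hk
  obtain ⟨w, hw, hw0⟩ := hl 0 (Nat.zero_le _)
  have hwne : ∀ s, w s ≠ 0 := by
    intro s hs
    have hex : ∃ i, w i = 0 := ⟨s, hs⟩
    simp only [lab, if_pos hex] at hw0
    have := lt_lastLabel (p := fun i => w i = 0) hs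
    omega
  have hnr : ¬ reach (cell w) := by
    intro hr
    have hex : ¬ ∃ i, w i = 0 := by push Not; exact hwne
    simp [lab, if_neg hex, if_pos hr] at hw0
  -- If `u i = 0` for the colour `i` of the cell of `w`, that cell lies on the starting face;
  -- otherwise it touches a reached cell of its colour. Either way it is reached, contrary to its
  -- label 0.
  obtain ⟨u, hu, hui⟩ := hl (c (cell w) + 1) (c (cell w)).2
  apply hnr
  rcases hmem u _ hui with h | ⟨hune, ⟨x, hx, hxc, hxr⟩, huc⟩
  · refine ⟨cell w, ?_, rfl, Relation.ReflTransGen.refl⟩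
    have h1 := hu (c (cell w))
    have h2 := hw (c (cell w))
    have h3 := hwne (c (cell w))
    change min (w (c (cell w)) - 1) (k - 1) = 0
    omega
  · rw [huc] at hx hxc hxr
    refine ⟨x, hx, hxc, hxr.tail ⟨fun s => ?_, huc, rfl⟩⟩
    have h1 := hu s
    have h2 := hw s
    simp only [cell]
    omega

/-! ### Covering dimension of cubes -/

/-- A space that retracts onto a `d`-dimensional cube has covering dimension at least `d`. -/
theorem not_hasCoveringDimLT {d : ℕ} {Y : Type*} [TopologicalSpace Y] (φ : unitCube d → Y)
    (hφ : Continuous φ) (t : Y → Fin d → ℝ) (ht : Continuous t) (htφ : ∀ x, t (φ x) = x) :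
    ¬ HasCoveringDimLT Y d := by
  classical
  intro hdim
  -- No member of this cover, hence none of a refinement, meets both `t i = 0` and `t i = 1`.
  let A : (Fin d → Bool) → Set Y := fun b =>
    {y | ∀ i, if b i then t y i < 1 else 0 < t y i}
  have hA : ∀ b, IsOpen (A b) := by
    intro b
    simp only [A, Set.ofPred_forall]
    refine isOpen_iInter_of_finite fun i => ?_
    have hti : Continuous fun y => t y i := (continuous_apply i).comp ht
    cases b i
    · simpa using isOpen_lt continuous_const hti
    · simpa using isOpen_lt hti continuous_const
  obtain ⟨V, -, hVo, hVc, hVA, hVd⟩ := hdim (Set.range A) (Set.finite_range A)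
    (by rintro _ ⟨b, rfl⟩; exact hA b) (by
      rw [Set.eq_univ_iff_forall]
      intro y
      refine ⟨_, ⟨fun i => decide (t y i < 1), rfl⟩, fun i => ?_⟩
      by_cases h : t y i < 1
      · simp [h]
      · simp only [h, decide_false, Bool.false_eq_true, if_false]
        linarith)
  have hcube : unitCube d = Set.Icc 0 1 := by
    ext z
    simp [unitCube, Pi.le_def, forall_and]
  have : CompactSpace (unitCube d) := by
    rw [hcube]
    exact isCompact_iff_compactSpace.mp isCompact_Icc
  obtain ⟨δ, hδ, hball⟩ := lebesgue_number_lemma_of_metric (s := (Set.univ : Set (unitCube d)))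
    (c := fun B : V => φ ⁻¹' (B : Set Y)) isCompact_univ (fun B => (hVo B B.2).preimage hφ) (by
      intro x _
      obtain ⟨B, hB, hx⟩ : φ x ∈ ⋃₀ V := by rw [hVc]; trivial
      exact Set.mem_iUnion.mpr ⟨⟨B, hB⟩, hx⟩)
  obtain ⟨N, hN⟩ := exists_nat_one_div_lt hδ
  have hN0 : (0 : ℝ) < (N : ℝ) + 1 := by positivity
  let pt : (Fin d → ℕ) → unitCube d := fun x =>
    ⟨fun s => min ((x s : ℝ) / (N + 1)) 1, fun s => ⟨le_min (by positivity) zero_le_one,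
      min_le_right _ _⟩⟩
  choose B hB using fun x : Fin d → ℕ => hball (pt x) (Set.mem_univ _)
  have hself : ∀ x, φ (pt x) ∈ (B x : Set Y) := fun x => hB x (Metric.mem_ball_self hδ)
  -- The label depends only on the chosen member `B x`, so `d + 1` labels on one small grid cube
  -- give `d + 1` members; the Lebesgue number puts a common point in all of them.
  let lab : (Fin d → ℕ) → ℕ := fun x => lastLabel fun i => ∃ y ∈ (B x : Set Y), t y i = 0
  have h0 : ∀ x, (∀ s, x s ≤ N + 1) → ∀ i : Fin d, x i = 0 → (i : ℕ) < lab x := by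
    intro x _ i hi
    refine lt_lastLabel (p := fun i => ∃ y ∈ (B x : Set Y), t y i = 0)
      ⟨φ (pt x), hself x, ?_⟩
    rw [htφ]
    simp [pt, hi]
  have hk : ∀ x, (∀ s, x s ≤ N + 1) → ∀ i : Fin d, x i = N + 1 → lab x ≠ i + 1 := by
    intro x _ i hi hx
    obtain ⟨y, hy, hy0⟩ := of_lastLabel_eq hx
    obtain ⟨_, ⟨b, rfl⟩, hb⟩ := hVA _ (B x).2
    have h1 := hb (hself x) i
    have h2 := hb hy i
    have h3 : t (φ (pt x)) i = 1 := by
      rw [htφ]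
      have : ((N : ℝ) + 1) / (N + 1) = 1 := div_self hN0.ne'
      simp [pt, hi, this]
    rw [h3] at h1
    rw [hy0] at h2
    cases hbi : b i <;> simp [hbi] at h1 h2
  obtain ⟨v, hv, hl⟩ := exists_unitCube_fullyLabelled (Nat.succ_pos N) lab
    (fun x => lastLabel_le _) h0 hk
  choose! x hx hxl using hl
  have hmem : ∀ l, l ≤ d → φ (pt v) ∈ (B (x l) : Set Y) := by
    intro l hl
    apply hB
    rw [Metric.mem_ball, Subtype.dist_eq]
    refine lt_of_le_of_lt ((dist_pi_le_iff (by positivity)).mpr fun s => ?_) hN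
    obtain ⟨h1, h2⟩ := hx l hl s
    have h1' : (v s : ℝ) ≤ x l s := by exact_mod_cast h1
    have h2' : (x l s : ℝ) ≤ v s + 1 := by exact_mod_cast h2
    simp only [pt]
    rw [Real.dist_eq]
    refine (abs_min_sub_min_le_max _ _ _ _).trans ?_
    rw [sub_self, abs_zero, ← sub_div, abs_div, abs_of_pos hN0]
    refine max_le ?_ (by positivity)
    apply div_le_div_of_nonneg_right _ hN0.le
    rw [abs_le]
    constructor <;> linarith
  have hcard := hVd (φ (pt v))
  have hsub : ((fun l => (B (x l) : Set Y)) '' (Finset.range (d + 1) : Set ℕ)) ⊆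
      {C ∈ V | φ (pt v) ∈ C} := by
    rintro _ ⟨l, hl, rfl⟩
    simp only [Finset.coe_range, Set.mem_Iio] at hl
    exact ⟨(B (x l)).2, hmem l (by omega)⟩
  have hinj : Set.InjOn (fun l => (B (x l) : Set Y)) (Finset.range (d + 1) : Set ℕ) := by
    intro l hl l' hl' h
    simp only [Finset.coe_range, Set.mem_Iio] at hl hl'
    rw [← hxl l (by omega), ← hxl l' (by omega)]
    simp only at h
    simp only [lab, h]
  have h1 := (Set.encard_le_encard hsub).trans hcard
  rw [hinj.encard_image, Set.encard_coe_eq_coe_finsetCard, Finset.card_range] at h1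
  have : d + 1 ≤ d := by exact_mod_cast h1
  omega

/-! ### Subcubes and touching cells -/

theorem gridCube_eq_Icc {n k : ℕ} (a : Fin n → Fin k) :
    gridCube n k a = Set.Icc (fun s => ((a s : ℕ) : ℝ) / k) (fun s => (((a s : ℕ) : ℝ) + 1) / k) := by
  ext z
  simp [gridCube, Pi.le_def, forall_and]

theorem isConnected_gridCube {n k : ℕ} (a : Fin n → Fin k) : IsConnected (gridCube n k a) := by
  rw [gridCube_eq_Icc]
  refine ⟨Set.nonempty_Icc.mpr fun s => ?_, (convex_Icc _ _).isPreconnected⟩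
  exact div_le_div_of_nonneg_right (by linarith) (Nat.cast_nonneg k)

theorem gridCube_subset_unitCube {n k : ℕ} (a : Fin n → Fin k) : gridCube n k a ⊆ unitCube n := by
  intro z hz s
  have hk : (0 : ℝ) < k := by exact_mod_cast (a s).pos
  refine ⟨le_trans (by positivity) (hz s).1, (hz s).2.trans ?_⟩
  rw [div_le_one hk]
  exact_mod_cast (a s).2

theorem Touching.max_mem {n k : ℕ} {a b : Fin n → Fin k} (h : Touching a b) (s : Fin n) :
    ((a s : ℕ) : ℝ) / k ≤ ((max (a s : ℕ) (b s) : ℕ) : ℝ) / k ∧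
      ((max (a s : ℕ) (b s) : ℕ) : ℝ) / k ≤ (((a s : ℕ) : ℝ) + 1) / k := by
  have hk : (0 : ℝ) ≤ k := Nat.cast_nonneg k
  have h1 : max (a s : ℕ) (b s) ≤ a s + 1 := max_le (Nat.le_succ _) (h s).2
  exact ⟨div_le_div_of_nonneg_right (by exact_mod_cast le_max_left _ _) hk,
    div_le_div_of_nonneg_right (by exact_mod_cast h1) hk⟩

theorem Touching.symm {n k : ℕ} {a b : Fin n → Fin k} (h : Touching a b) : Touching b a :=
  fun s => ⟨(h s).2, (h s).1⟩

theorem Touching.inter_nonempty {n k : ℕ} {a b : Fin n → Fin k} (h : Touching a b) :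
    (gridCube n k a ∩ gridCube n k b).Nonempty := by
  refine ⟨fun s => ((max (a s : ℕ) (b s) : ℕ) : ℝ) / k, fun s => h.max_mem s, fun s => ?_⟩
  simp only [max_comm (a s : ℕ)]
  exact h.symm.max_mem s

/-- The dimension of the common facet of two adjacent cubes. -/
theorem le_coveringDim_inter_gridCube {d k : ℕ} {a b : Fin (d + 1) → Fin k} (h : Touching a b)
    (j : Fin (d + 1)) (hj : ∀ s, s ≠ j → a s = b s) :
    (d : WithBot ℕ∞) ≤ coveringDim ↥(gridCube (d + 1) k a ∩ gridCube (d + 1) k b) := by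
  rw [le_coveringDim_iff]
  have hk : (0 : ℝ) < k := by exact_mod_cast (a j).pos
  have hmem : ∀ x : unitCube d,
      (j.insertNth (((max (a j : ℕ) (b j) : ℕ) : ℝ) / k)
        (fun s => (((a (j.succAbove s) : ℕ) : ℝ) + (x : Fin d → ℝ) s) / k) : Fin (d + 1) → ℝ) ∈
      gridCube (d + 1) k a ∩ gridCube (d + 1) k b := by
    intro x
    constructor
    · intro s
      refine Fin.succAboveCases j ?_ (fun s => ?_) s
      · simpa using h.max_mem j
      · have := x.2 s
        simp only [Fin.insertNth_apply_succAbove]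
        exact ⟨div_le_div_of_nonneg_right (by linarith) hk.le,
          div_le_div_of_nonneg_right (by linarith) hk.le⟩
    · intro s
      refine Fin.succAboveCases j ?_ (fun s => ?_) s
      · have := h.symm.max_mem j
        rw [max_comm] at this
        simpa using this
      · have := x.2 s
        simp only [Fin.insertNth_apply_succAbove, ← hj _ (Fin.succAbove_ne j s)]
        exact ⟨div_le_div_of_nonneg_right (by linarith) hk.le,
          div_le_div_of_nonneg_right (by linarith) hk.le⟩
  refine not_hasCoveringDimLT (fun x => ⟨_, hmem x⟩) ?_
    (fun y s => (y : Fin (d + 1) → ℝ) (j.succAbove s) * k - (a (j.succAbove s) : ℕ)) ?_ ?_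
  · refine Continuous.subtype_mk (Continuous.finInsertNth j continuous_const ?_) _
    refine continuous_pi fun s => ?_
    exact (continuous_const.add
      ((continuous_apply s).comp continuous_subtype_val)).div_const _
  · refine continuous_pi fun s => ?_
    exact (((continuous_apply (j.succAbove s)).comp continuous_subtype_val).mul
      continuous_const).sub continuous_const
  · intro x
    funext s
    simp only [Fin.insertNth_apply_succAbove]
    field_simp
    ring

/-- A map on the cells that is `1`-Lipschitz across facets is `n`-Lipschitz for touching cells. -/
theorem norm_sub_le_of_touching {n k : ℕ} {E : Type*} [SeminormedAddCommGroup E]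
    (G : (Fin n → Fin k) → E)
    (hG : ∀ a b, Touching a b → ∀ j, (∀ s, s ≠ j → a s = b s) → ‖G a - G b‖ ≤ 1)
    {a b : Fin n → Fin k} (h : Touching a b) : ‖G a - G b‖ ≤ n := by
  -- Coordinates of `a` are replaced by those of `b` one at a time.
  have key : ∀ T : Finset (Fin n), ‖G a - G (T.piecewise b a)‖ ≤ T.card := by
    intro T
    induction T using Finset.induction_on with
    | empty => simp
    | insert j T hjT ih =>
      rw [Finset.card_insert_of_notMem hjT]
      have h1 : ‖G (T.piecewise b a) - G ((insert j T).piecewise b a)‖ ≤ 1 := by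
        refine hG _ _ (fun s => ?_) j fun s hs => ?_
        · have := h s
          by_cases hs : s ∈ T <;> by_cases hs' : s ∈ insert j T <;>
            simp only [Finset.piecewise, hs, hs', if_true, if_false] <;> omega
        · simp [Finset.piecewise, hs]
      calc ‖G a - G ((insert j T).piecewise b a)‖
          = ‖(G a - G (T.piecewise b a)) +
              (G (T.piecewise b a) - G ((insert j T).piecewise b a))‖ := by
            rw [sub_add_sub_cancel]
        _ ≤ T.card + 1 := (norm_add_le _ _).trans (add_le_add ih h1)
        _ = ((T.card + 1 : ℕ) : ℝ) := by push_cast; rfl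
  have := key Finset.univ
  simpa using this

/-! ### Bricks in the integer lattice -/

/-- Boxes in `ℤ ^ d` are `1`-connected. -/
theorem isRConnected_Icc {d : ℕ} (lo hi : Fin d → ℤ) : IsRConnected 1 (Set.Icc lo hi) := by
  intro x hx y hy
  -- Every coordinate moves at unit speed and then waits; the sum is a time by which all have
  -- arrived.
  refine ⟨∑ s, (y s - x s).natAbs,
    fun t s => max (x s - (t : ℕ)) (min (x s + (t : ℕ)) (y s)), ?_, ?_, ?_, ?_⟩
  · intro j
    refine (dist_pi_le_iff zero_le_one).mpr fun s => ?_
    rw [Int.dist_eq]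
    have : |max (x s - ((j.castSucc : Fin _) : ℕ)) (min (x s + ((j.castSucc : Fin _) : ℕ)) (y s)) -
        max (x s - ((j.succ : Fin _) : ℕ)) (min (x s + ((j.succ : Fin _) : ℕ)) (y s))| ≤ 1 := by
      rw [abs_le]
      simp only [Fin.val_castSucc, Fin.val_succ]
      omega
    exact_mod_cast this
  · intro j
    rw [← Set.pi_univ_Icc]
    intro s _
    have h1 : lo s ≤ x s := hx.1 s
    have h2 : x s ≤ hi s := hx.2 s
    have h3 : lo s ≤ y s := hy.1 s
    have h4 : y s ≤ hi s := hy.2 s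
    simp only [Set.mem_Icc]
    omega
  · funext s
    simp
  · funext s
    have : (y s - x s).natAbs ≤ ∑ s, (y s - x s).natAbs :=
      Finset.single_le_sum (f := fun s => (y s - x s).natAbs) (fun _ _ => Nat.zero_le _)
        (Finset.mem_univ s)
    simp only [Fin.val_last]
    omega

theorem encard_Icc_add {d : ℕ} (lo : Fin d → ℤ) (w : ℕ) :
    (Set.Icc lo fun s => lo s + w - 1).encard = (w ^ d : ℕ) := by
  rw [← Finset.coe_Icc, Set.encard_coe_eq_coe_finsetCard, Pi.card_Icc]
  simp

/-- The floor quotient increases only on arriving at a multiple of `N`. -/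
theorem Int.ediv_le_ediv_of_le_add_one {u v N : ℤ} (hN : 0 < N) (h : v ≤ u + 1) (hv : ¬ N ∣ v) :
    v / N ≤ u / N := by
  rw [Int.le_ediv_iff_mul_le hN]
  have h1 := Int.ediv_mul_le v hN.ne'
  have h2 : v / N * N ≠ v := fun h => hv (Dvd.intro_left _ h)
  omega

/-- Each point of `ℤ ^ d` has one of `d + 1` colours such that no coordinate lies in a gap of that
colour. -/
theorem exists_colour {d : ℕ} (x : Fin d → ℤ) :
    ∃ j : Fin (d + 1), ∀ s, ¬ ((d + 1 : ℕ) : ℤ) ∣ x s - (j : ℕ) := by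
  by_contra! h
  choose s hs using h
  -- Two colours excluded by the same coordinate would be congruent modulo `d + 1`.
  have : Function.Injective s := by
    intro j j' hjj
    have h1 := hs j
    rw [hjj] at h1
    have h2 := dvd_sub h1 (hs j')
    have h3 := Int.eq_zero_of_abs_lt_dvd h2 (by
      have := j.2
      have := j'.2
      rw [abs_lt]
      omega)
    exact Fin.ext (by omega)
  have := Fintype.card_le_of_injective s this
  simp at this

/-- The brick of colour `j` and index `q` in `ℤ ^ d`. -/
def brick (d j : ℕ) (q : Fin d → ℤ) : Set (Fin d → ℤ) :=
  Set.Icc (fun s => (q s * (d + 1 : ℕ) + j) * (d + 1 : ℕ))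
    fun s => (q s * (d + 1 : ℕ) + j) * (d + 1 : ℕ) + ((d + 1) ^ 2 : ℕ) - 1

/-- The index of the brick of colour `j` that contains a point. -/
def brickIndex (d j : ℕ) (x : Fin d → ℤ) : Fin d → ℤ :=
  fun s => (x s / (d + 1 : ℕ) - j) / (d + 1 : ℕ)

theorem mem_brick_brickIndex {d : ℕ} (j : ℕ) (x : Fin d → ℤ) : x ∈ brick d j (brickIndex d j x) := by
  have hN : (0 : ℤ) < (d + 1 : ℕ) := by positivity
  constructor
  · intro s
    have h1 := Int.ediv_mul_le (x s / (d + 1 : ℕ) - j) hN.ne'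
    rw [← Int.le_ediv_iff_mul_le hN]
    simp only [brickIndex]
    omega
  · intro s
    have h1 := Int.lt_ediv_add_one_mul_self (x s / (d + 1 : ℕ) - j) hN
    have h2 : x s < ((brickIndex d j x s + 1) * (d + 1 : ℕ) + j) * (d + 1 : ℕ) := by
      rw [← Int.ediv_lt_iff_lt_mul hN]
      simp only [brickIndex]
      omega
    push_cast at h2 ⊢
    nlinarith

/-- A jump of at most `d + 1` changes block coordinates by at most 1, which is too little to pass a
gap in either direction. -/
theorem brickIndex_eq {d : ℕ} {j : ℕ} {x y : Fin d → ℤ} (hxy : ‖x - y‖ ≤ (d + 1 : ℕ))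
    (hx : ∀ s, ¬ ((d + 1 : ℕ) : ℤ) ∣ x s / (d + 1 : ℕ) - j)
    (hy : ∀ s, ¬ ((d + 1 : ℕ) : ℤ) ∣ y s / (d + 1 : ℕ) - j) :
    brickIndex d j x = brickIndex d j y := by
  have hN : (0 : ℤ) < (d + 1 : ℕ) := by positivity
  have hdiv : ∀ u v : ℤ, u ≤ v + (d + 1 : ℕ) → u / (d + 1 : ℕ) ≤ v / (d + 1 : ℕ) + 1 := by
    intro u v h
    have h1 := Int.ediv_le_ediv hN h
    rwa [Int.add_ediv_of_dvd_right (dvd_refl _), Int.ediv_self hN.ne'] at h1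
  funext s
  have hs : |x s - y s| ≤ (d + 1 : ℕ) := by
    have h := (norm_le_pi_norm (x - y) s).trans hxy
    rw [Pi.sub_apply, Int.norm_eq_abs] at h
    exact_mod_cast h
  rw [abs_le] at hs
  have h1 := hdiv (x s) (y s) (by omega)
  have h2 := hdiv (y s) (x s) (by omega)
  exact le_antisymm (Int.ediv_le_ediv_of_le_add_one hN (by omega) (hx s))
    (Int.ediv_le_ediv_of_le_add_one hN (by omega) (hy s))

/-! ### From chains of cubes to the theorem -/

theorem connectsOppositeFaces_of_path {n k : ℕ} {ι : Type*} {c : (Fin n → Fin k) → ι} {l : ι}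
    {i : Fin n} {x y : Fin n → Fin k} (hx : (x i : ℕ) = 0) (hy : (y i : ℕ) + 1 = k)
    (hxy : Relation.ReflTransGen (TouchingOfColour c l) x y) :
    ConnectsOppositeFaces n i
      (⋃ a ∈ {a | Relation.ReflTransGen (TouchingOfColour c l) x a}, gridCube n k a) := by
  have hk : (0 : ℝ) < k := by exact_mod_cast (x i).pos
  set T := {a | Relation.ReflTransGen (TouchingOfColour c l) x a} with hT
  have hxT : x ∈ T := Relation.ReflTransGen.refl
  have hsub : (⋃ a ∈ T, gridCube n k a) ⊆ unitCube n :=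
    Set.iUnion₂_subset fun a _ => gridCube_subset_unitCube a
  refine ⟨hsub, ?_, ?_, ?_⟩
  · have key : ∀ a ∈ T,
        Relation.ReflTransGen
          (fun a b => (gridCube n k a ∩ gridCube n k b).Nonempty ∧ a ∈ T) x a ∧
        Relation.ReflTransGen
          (fun a b => (gridCube n k a ∩ gridCube n k b).Nonempty ∧ a ∈ T) a x := by
      intro a ha
      induction ha with
      | refl => exact ⟨.refl, .refl⟩
      | tail hb hbc ih =>
        exact ⟨ih.1.tail ⟨hbc.1.inter_nonempty, hb⟩,
          ih.2.head ⟨hbc.1.symm.inter_nonempty, hb.tail hbc⟩⟩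
    exact IsConnected.biUnion_of_reflTransGen ⟨x, hxT⟩ (fun a _ => isConnected_gridCube a)
      fun a ha b hb => (key a ha).2.trans (key b hb).1
  · have hm : (fun s => ((x s : ℕ) : ℝ) / k) ∈ ⋃ a ∈ T, gridCube n k a :=
      Set.mem_biUnion hxT fun s =>
        ⟨le_rfl, div_le_div_of_nonneg_right (by linarith) hk.le⟩
    exact ⟨_, hm, hsub hm, by simp [hx]⟩
  · have hm : (fun s => (((y s : ℕ) : ℝ) + 1) / k) ∈ ⋃ a ∈ T, gridCube n k a :=
      Set.mem_biUnion hxy fun s =>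
        ⟨div_le_div_of_nonneg_right (by linarith) hk.le, le_rfl⟩
    refine ⟨_, hm, hsub hm, ?_⟩
    have : ((y i : ℕ) : ℝ) + 1 = k := by exact_mod_cast hy
    simp only [this]
    exact div_self hk.ne'

theorem exists_brick_connectsSomeOppositeFaces {d k : ℕ} (hk : 0 < k)
    (G : (Fin (d + 1) → Fin k) → Fin d → ℤ)
    (hG : ∀ a b, Touching a b → ∀ j, (∀ s, s ≠ j → a s = b s) → ‖G a - G b‖ ≤ 1) :
    ∃ (j : ℕ) (q : Fin d → ℤ) (T : Set (Fin (d + 1) → Fin k)), (∀ a ∈ T, G a ∈ brick d j q) ∧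
      ConnectsSomeOppositeFaces (d + 1) (⋃ a ∈ T, gridCube (d + 1) k a) := by
  choose c hc using fun a => exists_colour fun s => G a s / (d + 1 : ℕ)
  obtain ⟨i, x, y, hx, hy, -, hxy⟩ := exists_monochromatic_path hk c
  refine ⟨i, brickIndex d i (G x), _, fun a ha => ?_, i, connectsOppositeFaces_of_path hx hy hxy⟩
  have hq : brickIndex d i (G a) = brickIndex d i (G x) := by
    induction ha with
    | refl => rfl
    | @tail b e _ hbe ih =>
      rw [← ih]
      obtain ⟨ht, hb, he⟩ := hbe
      refine (brickIndex_eq (norm_sub_le_of_touching G hG ht) ?_ ?_).symm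
      · intro s; rw [← hb]; exact hc b s
      · intro s; rw [← he]; exact hc e s
  rw [← hq]
  exact mem_brick_brickIndex _ _

theorem theoremA (n m : ℕ) (hn : 1 ≤ n) (hm : m ≤ n - 1) :
    ∃ C : ℕ, 0 < C ∧
      ∀ (k : ℕ), 1 ≤ k → ∀ F : cubeFamily n k → (Fin (n - 1) → ℤ),
        (∀ K₁ K₂ : cubeFamily n k,
          (m : WithBot ℕ∞) ≤ coveringDim ↥((K₁ : Set (Fin n → ℝ)) ∩ (K₂ : Set (Fin n → ℝ))) →
            ‖F K₁ - F K₂‖ ≤ 1) →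
        ∃ P : Set (Fin (n - 1) → ℤ), IsRConnected 1 P ∧ P.encard ≤ C ∧
          ∃ S : Set (cubeFamily n k), S ⊆ F ⁻¹' P ∧
            ConnectsSomeOppositeFaces n (⋃ K ∈ S, (K : Set (Fin n → ℝ))) := by
  obtain ⟨d, rfl⟩ : ∃ d, n = d + 1 := ⟨n - 1, by omega⟩
  -- The constant is the number of lattice points of a brick.
  refine ⟨((d + 1) ^ 2) ^ d, by positivity, fun k hk F hF => ?_⟩
  let cube : (Fin (d + 1) → Fin k) → cubeFamily (d + 1) k := fun a => ⟨gridCube (d + 1) k a, a, rfl⟩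
  obtain ⟨j, q, T, hT, hconn⟩ := exists_brick_connectsSomeOppositeFaces (d := d) hk
    (fun a => F (cube a)) fun a b hab j hj =>
      hF (cube a) (cube b) (le_trans (by exact_mod_cast hm) (le_coveringDim_inter_gridCube hab j hj))
  refine ⟨brick d j q, isRConnected_Icc _ _, (encard_Icc_add _ _).le, cube '' T, ?_, ?_⟩
  · rintro _ ⟨a, ha, rfl⟩
    exact hT a ha
  · rw [Set.biUnion_image]
    exact hconn
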